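/- Let $R$ be a commutative ring with unity and let $S\subseteq R$ be a multiplicative subset ($1\in S$, and $st\in S$ for all $s,t\in S$) with $0\notin S$. A sequence of $R$-modules $M\xrightarrow{f}N\xrightarrow{g}L$ is called $S$-exact at $N$ if there is $s\in S$ with $s\operatorname{Ker}(g)\subseteq\operatorname{Im}(f)$ and $s\operatorname{Im}(f)\subseteq\operatorname{Ker}(g)$; a longer sequence is $S$-exact if it is $S$-exact at each inner term (the element $s$ may depend on the term). An $R$-module $F$ is $S$-flat if for every $S$-exact sequence $0\to A\to B\to C\to 0$ of $R$-modules the induced sequence $0\to A\otimes_RF\to B\otimes_RF\to C\otimes_RF\to 0$ is $S$-exact. The $S$-flat dimension $S\text{-}fd_R(M)\in\mathbb N\cup\{\infty\}$ of an $R$-module $M$ is the least $m\ge 0$ for which there is an $S$-exact sequence $0\to F_m\to\cdots\to F_1\to F_0\to M\to 0$ with all $F_i$ $S$-flat, and $\infty$ if there is no such $m$. The $S$-weak global dimension of $R$ is $$S\text{-w.gl.dim}(R)=\sup\{S\text{-}fd_R(M)\mid M \text{ is an } R\text{-module}\}\in\mathbb N\cup\{\infty\}.$$ Regard $S$ also as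 a multiplicative subset of the polynomial ring $R[x_1,\dots,x_n]$, consisting of constant polynomials. Then for every integer $n\ge 1$, $$S\text{-w.gl.dim}(R[x_1,\dots,x_n])=S\text{-w.gl.dim}(R)+n,$$ where $\infty+n=\infty$. -/

import Mathlib

/-!
A module `F` is `S`-flat exactly when, for every injective `f`, the kernel of `f ⊗ F` is annihilated
by an element of `S`. Modules annihilated by an element of `S` are therefore `S`-flat, so that
`S`-flat dimension is invariant under maps whose kernel and cokernel are of that kind. Since an
`S`-exact sequence differs from an exact one by such maps only, the `S`-flat dimension can be read
off the syzygies in ordinary projective resolutions, where the usual dimension shifting applies.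

It then suffices to adjoin one variable. For an `A[X]`-module `M`, the exact sequence
`0 → M[X] → M[X] → M → 0` with first map `X ⊗ 1 - 1 ⊗ X` bounds the dimension of `M` over `A[X]` by
its dimension over `A` plus one. Conversely, let `X` kill `M` and let `0 → L → P[X] → M → 0` be
exact with `P` projective over `A`. Then `M` is a direct summand of `L / X L`, so if `M` has
dimension at most `1` over `A[X]`, it is `S`-flat over `A`; dimension shifting gives the bound in
higher dimensions. That the dimension over `A[X]` is not zero is seen on `A` itself: the regular
element `X` kills it, but no element of `S` does.
-/

open scoped TensorProduct

universe u

/-- The sequence `M --f--> N --g--> L` is `S`-exact at `N`: there is `s ∈ S` with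
`s Ker(g) ⊆ Im(f)` and `s Im(f) ⊆ Ker(g)`. The composite `g ∘ f` need not vanish. -/
def SExact {R : Type*} [CommRing R] (S : Submonoid R) {M N L : Type*}
    [AddCommGroup M] [Module R M] [AddCommGroup N] [Module R N] [AddCommGroup L] [Module R L]
    (f : M →ₗ[R] N) (g : N →ₗ[R] L) : Prop :=
  ∃ s ∈ S, (∀ x ∈ LinearMap.ker g, s • x ∈ LinearMap.range f) ∧
    (∀ y ∈ LinearMap.range f, s • y ∈ LinearMap.ker g)

/-- The sequence `0 → A --f--> B --g--> C → 0` is `S`-exact (at `A`, at `B` and at `C`). -/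
def ShortSExact {R : Type*} [CommRing R] (S : Submonoid R) {A B C : Type*}
    [AddCommGroup A] [Module R A] [AddCommGroup B] [Module R B] [AddCommGroup C] [Module R C]
    (f : A →ₗ[R] B) (g : B →ₗ[R] C) : Prop :=
  SExact S (0 : PUnit.{1} →ₗ[R] A) f ∧ SExact S f g ∧ SExact S g (0 : C →ₗ[R] PUnit.{1})

/-- `F` is `S`-flat: tensoring with `F` preserves `S`-exactness of short sequences. -/
def IsSFlat {R : Type u} [CommRing R] (S : Submonoid R)
    (F : Type u) [AddCommGroup F] [Module R F] : Prop :=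
  ∀ (A B C : Type u) [AddCommGroup A] [Module R A] [AddCommGroup B] [Module R B]
    [AddCommGroup C] [Module R C] (f : A →ₗ[R] B) (g : B →ₗ[R] C),
    ShortSExact S f g → ShortSExact S (f.rTensor F) (g.rTensor F)

/-- `M` has an `S`-flat `S`-resolution `0 → F n → ⋯ → F 1 → F 0 → M → 0` of length `n`: an
`S`-exact sequence with all `F i` `S`-flat, continued to the left by zero modules `F i`, `i > n`. -/
def HasSFlatSResolution {R : Type u} [CommRing R] (S : Submonoid R)
    (M : Type u) [AddCommGroup M] [Module R M] (n : ℕ) : Prop :=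
  ∃ (F : ℕ → ModuleCat.{u} R) (d : ∀ i, F (i + 1) →ₗ[R] F i) (ε : F 0 →ₗ[R] M),
    (∀ i ≤ n, IsSFlat S (F i)) ∧
    (∀ i, n < i → Subsingleton (F i)) ∧
    (∀ i, SExact S (d (i + 1)) (d i)) ∧
    SExact S (d 0) ε ∧
    SExact S ε (0 : M →ₗ[R] PUnit.{1})

/-- The `S`-flat dimension of `M`: the length of the shortest `S`-flat `S`-resolution of `M`, and
`⊤` if there is none of finite length. -/
noncomputable def sFlatDim {R : Type u} [CommRing R] (S : Submonoid R)
    (M : Type u) [AddCommGroup M] [Module R M] : ℕ∞ :=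
  ⨅ (n : ℕ) (_ : HasSFlatSResolution S M n), (n : ℕ∞)

/-- The `S`-weak global dimension of `R`: the supremum of the `S`-flat dimensions of all
`R`-modules. -/
noncomputable def sWeakGlobalDim {R : Type u} [CommRing R] (S : Submonoid R) : ℕ∞ :=
  ⨆ M : ModuleCat.{u} R, sFlatDim S M

section SExact

variable {R : Type*} [CommRing R] {S : Submonoid R} {A B C : Type*}
  [AddCommGroup A] [Module R A] [AddCommGroup B] [Module R B] [AddCommGroup C] [Module R C]
  {f : A →ₗ[R] B} {g : B →ₗ[R] C}

theorem sExact_zero_left_iff :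
    SExact S (0 : PUnit.{1} →ₗ[R] A) f ↔ ∃ s ∈ S, ∀ x, f x = 0 → s • x = 0 := by
  simp [SExact]

theorem sExact_zero_right_iff :
    SExact S g (0 : C →ₗ[R] PUnit.{1}) ↔ ∃ s ∈ S, ∀ y, ∃ x, g x = s • y := by
  simp [SExact]

theorem sExact_of_exact (h : Function.Exact f g) : SExact S f g :=
  ⟨1, S.one_mem, fun x hx => by simpa using (h x).1 hx, fun y hy => by simpa using (h y).2 hy⟩

theorem sExact_zero_left_of_injective (hf : Function.Injective f) :
    SExact S (0 : PUnit.{1} →ₗ[R] A) f :=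
  sExact_of_exact ((f.exact_zero_iff_injective _).2 hf)

theorem sExact_zero_right_of_surjective (hg : Function.Surjective g) :
    SExact S g (0 : C →ₗ[R] PUnit.{1}) :=
  sExact_of_exact ((g.exact_zero_iff_surjective _).2 hg)

theorem exists_comp_eq_of_ker_le_ker (hf : Function.Surjective f) {h : A →ₗ[R] C}
    (hfh : LinearMap.ker f ≤ LinearMap.ker h) : ∃ k : B →ₗ[R] C, k ∘ₗ f = h :=
  ⟨(LinearMap.ker f).liftQ h hfh ∘ₗ (f.quotKerEquivOfSurjective hf).symm, by
    ext x
    have : (f.quotKerEquivOfSurjective hf).symm (f x) = (LinearMap.ker f).mkQ x :=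
      (LinearEquiv.symm_apply_eq _).2 rfl
    simp [this]⟩

/-- An `S`-isomorphism: a linear map that is invertible up to an element of `S`. Equivalently, its
kernel and its cokernel are each annihilated by an element of `S`. -/
def IsSIso (S : Submonoid R) (f : A →ₗ[R] B) : Prop :=
  ∃ s ∈ S, ∃ g : B →ₗ[R] A, g ∘ₗ f = s • LinearMap.id ∧ f ∘ₗ g = s • LinearMap.id

theorem IsSIso.of_sExact (hker : SExact S (0 : PUnit.{1} →ₗ[R] A) f)
    (hcoker : SExact S f (0 : B →ₗ[R] PUnit.{1})) : IsSIso S f := by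
  obtain ⟨s, hs, hker⟩ := sExact_zero_left_iff.1 hker
  obtain ⟨t, ht, hcoker⟩ := sExact_zero_right_iff.1 hcoker
  obtain ⟨k, hk⟩ := exists_comp_eq_of_ker_le_ker f.surjective_rangeRestrict
    (h := s • LinearMap.id) fun x hx => by simpa using hker x (congrArg Subtype.val hx)
  replace hk (x : A) : k (f.rangeRestrict x) = s • x := LinearMap.congr_fun hk x
  let g : B →ₗ[R] A := k ∘ₗ (t • LinearMap.id).codRestrict (LinearMap.range f) hcoker
  have hg {x : A} {y : B} (hxy : f x = t • y) : g y = s • x := by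
    rw [← hk]
    exact congrArg k (Subtype.ext hxy.symm)
  refine ⟨s * t, S.mul_mem hs ht, g, LinearMap.ext fun x => ?_, LinearMap.ext fun y => ?_⟩
  · simp [hg (map_smul f t x), mul_smul]
  · obtain ⟨x, hx⟩ := hcoker y
    simp [hg hx, hx, mul_smul]

theorem SExact.exists_isSIso_quotient_range (h : SExact S f g)
    (hg : SExact S g (0 : C →ₗ[R] PUnit.{1})) :
    ∃ φ : (B ⧸ LinearMap.range f) →ₗ[R] C, IsSIso S φ ∧
      ∃ s ∈ S, φ ∘ₗ (LinearMap.range f).mkQ = s • g := by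
  obtain ⟨s, hs, hker, hrange⟩ := h
  obtain ⟨t, ht, hg⟩ := sExact_zero_right_iff.1 hg
  let φ : (B ⧸ LinearMap.range f) →ₗ[R] C := (LinearMap.range f).liftQ (s • g) fun y hy => by
    simpa using hrange y hy
  refine ⟨φ, .of_sExact (sExact_zero_left_iff.2 ⟨s * s, S.mul_mem hs hs, fun x hx => ?_⟩)
    (sExact_zero_right_iff.2 ⟨s * t, S.mul_mem hs ht, fun z => ?_⟩), s, hs,
    Submodule.liftQ_mkQ _ _ _⟩
  · obtain ⟨y, rfl⟩ := Submodule.mkQ_surjective _ x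
    have hy : s • y ∈ LinearMap.ker g := by simpa [φ] using hx
    rw [← map_smul, mul_smul]
    exact (Submodule.Quotient.mk_eq_zero _).2 (hker _ hy)
  · obtain ⟨y, hy⟩ := hg z
    exact ⟨(LinearMap.range f).mkQ y, by simp [φ, hy, mul_smul]⟩

variable (F : Type*) [AddCommGroup F] [Module R F]

theorem SExact.rTensor_zero_right (hg : SExact S g (0 : C →ₗ[R] PUnit.{1})) :
    SExact S (g.rTensor F) (0 : C ⊗[R] F →ₗ[R] PUnit.{1}) := by
  obtain ⟨s, hs, hg⟩ := sExact_zero_right_iff.1 hg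
  refine sExact_zero_right_iff.2 ⟨s, hs, fun z => ?_⟩
  induction z with
  | zero => exact ⟨0, by simp⟩
  | add z w hz hw =>
    obtain ⟨x, hx⟩ := hz
    obtain ⟨y, hy⟩ := hw
    exact ⟨x + y, by simp [hx, hy]⟩
  | tmul c m =>
    obtain ⟨b, hb⟩ := hg c
    exact ⟨b ⊗ₜ m, by simp [hb, TensorProduct.smul_tmul']⟩

theorem SExact.rTensor (h : SExact S f g) (hg : SExact S g (0 : C →ₗ[R] PUnit.{1})) :
    SExact S (f.rTensor F) (g.rTensor F) := by
  obtain ⟨φ, ⟨r, hr, ψ, hψφ, -⟩, s, hs, hφ⟩ := h.exists_isSIso_quotient_range hg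
  have hmkQ : r • (LinearMap.range f).mkQ = s • ψ ∘ₗ g := by
    rw [← LinearMap.comp_smul, ← hφ, ← LinearMap.comp_assoc, hψφ, LinearMap.smul_comp,
      LinearMap.id_comp]
  have hgf : s • g ∘ₗ f = 0 := by
    rw [← LinearMap.smul_comp, ← hφ, LinearMap.comp_assoc, LinearMap.range_mkQ_comp,
      LinearMap.comp_zero]
  refine ⟨r * s, S.mul_mem hr hs, fun x hx => ?_, ?_⟩
  · refine (rTensor_exact F f.exact_map_mkQ_range (Submodule.mkQ_surjective _) _).1 ?_
    rw [mul_comm, mul_smul, map_smul, map_smul, ← LinearMap.smul_apply r, ← LinearMap.rTensor_smul,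
      hmkQ, LinearMap.rTensor_smul, LinearMap.rTensor_comp]
    simp [LinearMap.mem_ker.1 hx]
  · rintro _ ⟨y, rfl⟩
    rw [LinearMap.mem_ker, mul_smul, map_smul, map_smul, ← LinearMap.comp_apply,
      ← LinearMap.rTensor_comp, ← LinearMap.smul_apply s, ← LinearMap.rTensor_smul, hgf]
    simp

end SExact

section SFlat

variable {R : Type u} [CommRing R] {S : Submonoid R}

theorem lTensor_rTensor_comm_apply {A B X Y : Type*} [AddCommGroup A] [Module R A]
    [AddCommGroup B] [Module R B] [AddCommGroup X] [Module R X] [AddCommGroup Y] [Module R Y]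
    (f : X →ₗ[R] Y) (g : A →ₗ[R] B) (x : X ⊗[R] A) :
    g.lTensor Y (f.rTensor A x) = f.rTensor B (g.lTensor X x) := by
  rw [← LinearMap.comp_apply, ← LinearMap.comp_apply, LinearMap.lTensor_comp_rTensor,
    LinearMap.rTensor_comp_lTensor]

theorem isSFlat_iff {F : Type u} [AddCommGroup F] [Module R F] :
    IsSFlat S F ↔ ∀ (A B : Type u) [AddCommGroup A] [Module R A] [AddCommGroup B] [Module R B]
      (f : A →ₗ[R] B), Function.Injective f → ∃ s ∈ S, ∀ x, f.rTensor F x = 0 → s • x = 0 := by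
  refine ⟨fun h A B _ _ _ _ f hf => ?_, fun h A B C _ _ _ _ _ _ f g ⟨hf, hfg, hg⟩ =>
    ⟨?_, hfg.rTensor F hg, hg.rTensor_zero_right F⟩⟩
  · exact sExact_zero_left_iff.1 (h A B (B ⧸ LinearMap.range f) f (LinearMap.range f).mkQ
      ⟨sExact_zero_left_of_injective hf, sExact_of_exact f.exact_map_mkQ_range,
        sExact_zero_right_of_surjective (Submodule.mkQ_surjective _)⟩).1
  · have hker : SExact S (0 : PUnit.{1} →ₗ[R] A) f.rangeRestrict := by
      simpa only [sExact_zero_left_iff, ← LinearMap.mem_ker, LinearMap.ker_rangeRestrict] using hf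
    obtain ⟨s, hs, k, hk, -⟩ :=
      IsSIso.of_sExact hker (sExact_zero_right_of_surjective f.surjective_rangeRestrict)
    obtain ⟨t, ht, h⟩ := h _ _ (LinearMap.range f).subtype (LinearMap.range f).injective_subtype
    refine sExact_zero_left_iff.2 ⟨t * s, S.mul_mem ht hs, fun x hx => ?_⟩
    have hx' : t • f.rangeRestrict.rTensor F x = 0 := h _ <| by
      rwa [← LinearMap.comp_apply, ← LinearMap.rTensor_comp, LinearMap.subtype_comp_codRestrict]
    calc (t * s) • x = k.rTensor F (t • f.rangeRestrict.rTensor F x) := by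
          rw [map_smul, ← LinearMap.comp_apply, ← LinearMap.rTensor_comp, hk]
          simp [mul_smul]
      _ = 0 := by rw [hx', map_zero]

variable {A B C : Type u} [AddCommGroup A] [Module R A] [AddCommGroup B] [Module R B]
  [AddCommGroup C] [Module R C]

theorem IsSFlat.of_flat [Module.Flat R A] : IsSFlat S A :=
  isSFlat_iff.2 fun _ _ _ _ _ _ f hf => ⟨1, S.one_mem, fun x hx => by
    rw [Module.Flat.rTensor_preserves_injective_linearMap f hf (hx.trans (map_zero _).symm),
      smul_zero]⟩

theorem IsSFlat.of_comp_eq_smul (hB : IsSFlat S B) {s : R} (hs : s ∈ S) (i : A →ₗ[R] B)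
    (p : B →ₗ[R] A) (hpi : p ∘ₗ i = s • LinearMap.id) : IsSFlat S A :=
  isSFlat_iff.2 fun X Y _ _ _ _ f hf => by
    obtain ⟨t, ht, h⟩ := isSFlat_iff.1 hB X Y f hf
    refine ⟨t * s, S.mul_mem ht hs, fun x hx => ?_⟩
    have hx' : t • i.lTensor X x = 0 :=
      h _ (by rw [← lTensor_rTensor_comm_apply, hx, map_zero])
    calc (t * s) • x = p.lTensor X (t • i.lTensor X x) := by
          rw [map_smul, ← LinearMap.comp_apply, ← LinearMap.lTensor_comp, hpi]
          simp [mul_smul]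
      _ = 0 := by rw [hx', map_zero]

theorem IsSFlat.of_retract (hB : IsSFlat S B) (i : A →ₗ[R] B) (p : B →ₗ[R] A)
    (hpi : p ∘ₗ i = LinearMap.id) : IsSFlat S A :=
  hB.of_comp_eq_smul S.one_mem i p (by rw [hpi, one_smul])

theorem IsSFlat.congr (hB : IsSFlat S B) (e : A ≃ₗ[R] B) : IsSFlat S A :=
  hB.of_retract e.toLinearMap e.symm.toLinearMap e.symm_comp

theorem IsSFlat.of_smul_eq_zero {s : R} (hs : s ∈ S) (h : ∀ a : A, s • a = 0) : IsSFlat S A :=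
  (IsSFlat.of_flat (A := PUnit.{u + 1})).of_comp_eq_smul hs 0 0 (by ext a; simp [h])

theorem exists_projective_surjective (Y : Type u) [AddCommGroup Y] [Module R Y] :
    ∃ (P : Type u) (_ : AddCommGroup P) (_ : Module R P) (q : P →ₗ[R] Y),
      Module.Projective R P ∧ Function.Surjective q :=
  ⟨Y →₀ R, inferInstance, inferInstance, Finsupp.linearCombination R id, inferInstance,
    Finsupp.linearCombination_id_surjective R Y⟩

variable {f : A →ₗ[R] B} {g : B →ₗ[R] C}

/-- The kernel of `Y ⊗ A → Y ⊗ B` is a quotient of `Tor₁(Y, C)`: chase a projective presentation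
of `Y`. -/
theorem IsSFlat.exists_smul_ker_lTensor (hC : IsSFlat S C) (hf : Function.Injective f)
    (hfg : Function.Exact f g) (hg : Function.Surjective g)
    (Y : Type u) [AddCommGroup Y] [Module R Y] :
    ∃ s ∈ S, ∀ y, f.lTensor Y y = 0 → s • y = 0 := by
  obtain ⟨P, _, _, q, _, hq⟩ := exists_projective_surjective (R := R) Y
  let j := (LinearMap.ker q).subtype
  have hjq : Function.Exact j q := LinearMap.exact_subtype_ker_map q
  obtain ⟨s, hs, hsC⟩ := isSFlat_iff.1 hC _ _ j (LinearMap.ker q).injective_subtype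
  refine ⟨s, hs, fun y hy => ?_⟩
  obtain ⟨p, rfl⟩ := LinearMap.rTensor_surjective A hq y
  rw [lTensor_rTensor_comm_apply] at hy
  obtain ⟨k, hk⟩ := (rTensor_exact B hjq hq _).1 hy
  have hgk : g.lTensor _ (s • k) = 0 := by
    rw [map_smul]
    refine hsC _ ?_
    rw [← lTensor_rTensor_comm_apply, hk, ← LinearMap.comp_apply, ← LinearMap.lTensor_comp,
      hfg.linearMap_comp_eq_zero, LinearMap.lTensor_zero, LinearMap.zero_apply]
  obtain ⟨l, hl⟩ := (lTensor_exact _ hfg hg _).1 hgk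
  have hjl : j.rTensor A l = s • p := by
    apply Module.Flat.lTensor_preserves_injective_linearMap (M := P) f hf
    rw [lTensor_rTensor_comm_apply, hl, map_smul, map_smul, hk]
  rw [← map_smul, ← hjl]
  exact (rTensor_exact A hjq hq).apply_apply_eq_zero l

theorem IsSFlat.extension (hA : IsSFlat S A) (hC : IsSFlat S C) (hf : Function.Injective f)
    (hfg : Function.Exact f g) (hg : Function.Surjective g) : IsSFlat S B :=
  isSFlat_iff.2 fun X Y _ _ _ _ h hh => by
    obtain ⟨s, hs, hsC⟩ := isSFlat_iff.1 hC X Y h hh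
    obtain ⟨t, ht, htf⟩ := hC.exists_smul_ker_lTensor hf hfg hg Y
    obtain ⟨r, hr, hrA⟩ := isSFlat_iff.1 hA X Y h hh
    refine ⟨r * (t * s), S.mul_mem hr (S.mul_mem ht hs), fun z hz => ?_⟩
    have hgz : g.lTensor X (s • z) = 0 := by
      rw [map_smul]
      exact hsC _ (by rw [← lTensor_rTensor_comm_apply, hz, map_zero])
    obtain ⟨w, hw⟩ := (lTensor_exact X hfg hg _).1 hgz
    have hhw : h.rTensor A (t • w) = 0 := by
      rw [map_smul]
      exact htf _ (by rw [lTensor_rTensor_comm_apply, hw, map_smul, hz, smul_zero])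
    rw [mul_smul, mul_smul, ← hw, ← map_smul, ← map_smul, hrA _ hhw, map_zero]

theorem IsSFlat.ker (hB : IsSFlat S B) (hC : IsSFlat S C) (hf : Function.Injective f)
    (hfg : Function.Exact f g) (hg : Function.Surjective g) : IsSFlat S A :=
  isSFlat_iff.2 fun X Y _ _ _ _ h hh => by
    obtain ⟨s, hs, hsB⟩ := isSFlat_iff.1 hB X Y h hh
    obtain ⟨t, ht, htf⟩ := hC.exists_smul_ker_lTensor hf hfg hg X
    refine ⟨t * s, S.mul_mem ht hs, fun z hz => ?_⟩
    have hfz : f.lTensor X (s • z) = 0 := by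
      rw [map_smul]
      exact hsB _ (by rw [← lTensor_rTensor_comm_apply, hz, map_zero])
    rw [mul_smul, htf _ hfz]

end SFlat

section Kernels

variable {R A B C P : Type*} [CommRing R] [AddCommGroup A] [Module R A] [AddCommGroup B]
  [Module R B] [AddCommGroup C] [Module R C] [AddCommGroup P] [Module R P]

/-- The identification of the left term of a left exact sequence `0 → A → B → C` with the kernel
of `B → C`. -/
noncomputable def equivKerOfExact {f : A →ₗ[R] B} {g : B →ₗ[R] C} (hf : Function.Injective f)
    (hfg : Function.Exact f g) : A ≃ₗ[R] LinearMap.ker g :=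
  (LinearEquiv.ofInjective f hf).trans (LinearEquiv.ofEq _ _ hfg.linearMap_ker_eq.symm)

/-- The map `ker (g ∘ p) → ker g` induced by `p`. -/
def kerCompToKer (p : A →ₗ[R] B) (g : B →ₗ[R] C) :
    LinearMap.ker (g ∘ₗ p) →ₗ[R] LinearMap.ker g :=
  p.restrict fun _ hx => hx

theorem kerCompToKer_surjective {p : A →ₗ[R] B} (hp : Function.Surjective p) (g : B →ₗ[R] C) :
    Function.Surjective (kerCompToKer p g) := by
  rintro ⟨b, hb⟩
  obtain ⟨a, rfl⟩ := hp b
  exact ⟨⟨a, hb⟩, rfl⟩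

theorem exact_inclusion_kerCompToKer (p : A →ₗ[R] B) (g : B →ₗ[R] C) :
    Function.Exact (Submodule.inclusion (LinearMap.ker_le_ker_comp p g)) (kerCompToKer p g) :=
  fun x => ⟨fun hx => ⟨⟨x, congrArg Subtype.val hx⟩, rfl⟩, by
    rintro ⟨y, rfl⟩
    exact Subtype.ext y.2⟩

variable {f : A →ₗ[R] B} {g : B →ₗ[R] C}

theorem surjective_coprod_of_exact (hfg : Function.Exact f g) {q : P →ₗ[R] B}
    (hq : Function.Surjective (g ∘ₗ q)) : Function.Surjective (f.coprod q) := fun b => by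
  obtain ⟨x, hx⟩ := hq (g b)
  obtain ⟨a, ha⟩ := (hfg (b - q x)).1 (by simpa [sub_eq_zero] using hx.symm)
  exact ⟨(a, x), by simp [ha]⟩

/-- If `0 → A → B → C` is left exact, the fibre product of `A → B` and `q : P → B` is the kernel
of the composite `P → C`. It is encoded as the kernel of `(a, x) ↦ f a + q x`. -/
noncomputable def kerCoprodEquiv (hf : Function.Injective f) (hfg : Function.Exact f g)
    (q : P →ₗ[R] B) : LinearMap.ker (f.coprod q) ≃ₗ[R] LinearMap.ker (g ∘ₗ q) :=
  LinearEquiv.ofBijective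
    ((LinearMap.snd R A P).restrict fun x hx => by
      simpa [hfg.apply_apply_eq_zero] using congrArg g (LinearMap.mem_ker.1 hx)) <| by
    refine ⟨(injective_iff_map_eq_zero _).2 ?_, ?_⟩
    · rintro ⟨⟨a, x⟩, hx⟩ h
      obtain rfl : x = 0 := congrArg Subtype.val h
      obtain rfl : a = 0 := hf (by simpa using hx)
      rfl
    · rintro ⟨x, hx⟩
      obtain ⟨a, ha⟩ := (hfg (q x)).1 hx
      exact ⟨⟨(-a, x), by simp [ha]⟩, rfl⟩

end Kernels

section SFlatDimLE

variable {R : Type u} [CommRing R]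

/-- `M` has `S`-flat dimension at most `n`, in the form that the `n`-th syzygy of `M` with respect
to some projective resolution is `S`-flat. Unlike `HasSFlatSResolution`, this only involves
ordinary exact sequences. -/
def SFlatDimLE (S : Submonoid R) : ℕ → ∀ (M : Type u) [AddCommGroup M] [Module R M], Prop
  | 0, M, _, _ => IsSFlat S M
  | n + 1, M, _, _ => ∃ (P : Type u) (_ : AddCommGroup P) (_ : Module R P) (p : P →ₗ[R] M),
      Module.Projective R P ∧ Function.Surjective p ∧ SFlatDimLE S n (LinearMap.ker p)

variable {S : Submonoid R} {A B C : Type u} [AddCommGroup A] [Module R A]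
  [AddCommGroup B] [Module R B] [AddCommGroup C] [Module R C] {n : ℕ}

namespace SFlatDimLE

theorem congr (hB : SFlatDimLE S n B) (e : A ≃ₗ[R] B) : SFlatDimLE S n A := by
  cases n with
  | zero => exact IsSFlat.congr hB e
  | succ n =>
    obtain ⟨P, _, _, p, hP, hp, h⟩ := hB
    exact ⟨P, inferInstance, inferInstance, e.symm.toLinearMap ∘ₗ p, hP,
      e.symm.surjective.comp hp, by rwa [LinearEquiv.ker_comp]⟩

variable {f : A →ₗ[R] B} {g : B →ₗ[R] C}

theorem succ_of_exact [Module.Projective R B] (hA : SFlatDimLE S n A)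
    (hf : Function.Injective f) (hfg : Function.Exact f g) (hg : Function.Surjective g) :
    SFlatDimLE S (n + 1) C :=
  ⟨B, inferInstance, inferInstance, g, inferInstance, hg, hA.congr (equivKerOfExact hf hfg).symm⟩

theorem of_projective [Module.Projective R A] : SFlatDimLE S n A := by
  induction n generalizing A with
  | zero => exact IsSFlat.of_flat
  | succ n ih =>
    exact (ih (A := PUnit)).succ_of_exact (f := 0) (g := LinearMap.id)
      (Function.injective_of_subsingleton _) ((LinearMap.id.exact_zero_iff_injective _).2
        Function.injective_id) Function.surjective_id

theorem prod_projective [Module.Projective R B] (hA : SFlatDimLE S n A) :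
    SFlatDimLE S n (A × B) := by
  cases n with
  | zero =>
    exact IsSFlat.extension hA IsSFlat.of_flat (f := LinearMap.inl R A B)
      (g := LinearMap.snd R A B) LinearMap.inl_injective .inl_snd LinearMap.snd_surjective
  | succ n =>
    obtain ⟨P, _, _, p, _, hp, hA⟩ := hA
    refine hA.succ_of_exact (f := LinearMap.inl R P B ∘ₗ (LinearMap.ker p).subtype)
      (g := p.prodMap LinearMap.id)
      (LinearMap.inl_injective.comp (LinearMap.ker p).injective_subtype) ?_
      (hp.prodMap Function.surjective_id)
    rintro ⟨x, y⟩
    simp [Prod.ext_iff, eq_comm]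

theorem extension (hA : SFlatDimLE S n A) (hC : SFlatDimLE S n C)
    (hf : Function.Injective f) (hfg : Function.Exact f g) (hg : Function.Surjective g) :
    SFlatDimLE S n B := by
  induction n generalizing A B C with
  | zero => exact IsSFlat.extension hA hC hf hfg hg
  | succ n ih =>
    obtain ⟨Q, _, _, q, _, hq, hC⟩ := hC
    obtain ⟨q', rfl⟩ := Module.projective_lifting_property g q hg
    obtain ⟨P, _, _, p, _, hp, hAQ⟩ := hA.prod_projective (B := Q)
    exact ⟨P, inferInstance, inferInstance, f.coprod q' ∘ₗ p, inferInstance,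
      (surjective_coprod_of_exact hfg hq).comp hp,
      ih hAQ (hC.congr (kerCoprodEquiv hf hfg q')) (Submodule.inclusion_injective _)
        (exact_inclusion_kerCompToKer p _) (kerCompToKer_surjective hp _)⟩

theorem coker (hA : SFlatDimLE S n A) (hB : SFlatDimLE S (n + 1) B)
    (hf : Function.Injective f) (hfg : Function.Exact f g) (hg : Function.Surjective g) :
    SFlatDimLE S (n + 1) C := by
  obtain ⟨P, _, _, p, hP, hp, hB⟩ := hB
  exact ⟨P, inferInstance, inferInstance, g ∘ₗ p, hP, hg.comp hp,
    hB.extension (hA.congr (equivKerOfExact hf hfg).symm) (Submodule.inclusion_injective _)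
      (exact_inclusion_kerCompToKer p g) (kerCompToKer_surjective hp g)⟩

theorem of_prod_projective [Module.Projective R B] (h : SFlatDimLE S n (A × B)) :
    SFlatDimLE S n A := by
  cases n with
  | zero => exact IsSFlat.of_retract h (LinearMap.inl R A B) (LinearMap.fst R A B) rfl
  | succ n =>
    exact (of_projective (A := B)).coker h LinearMap.inr_injective .inr_fst
      LinearMap.fst_surjective

/-- Pulling back a projective cover `P → C` along `B → C` gives `0 → K → A × P → B → 0` with `K`
the first syzygy of `C`. -/
theorem ker (hB : SFlatDimLE S n B) (hC : SFlatDimLE S (n + 1) C)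
    (hf : Function.Injective f) (hfg : Function.Exact f g) (hg : Function.Surjective g) :
    SFlatDimLE S n A := by
  obtain ⟨P, _, _, p, _, hp, hC⟩ := hC
  obtain ⟨q, rfl⟩ := Module.projective_lifting_property g p hg
  exact of_prod_projective (B := P) <| (hC.congr (kerCoprodEquiv hf hfg q)).extension hB
    (Submodule.injective_subtype _) (LinearMap.exact_subtype_ker_map _)
    (surjective_coprod_of_exact hfg hp)

theorem succ (h : SFlatDimLE S n A) : SFlatDimLE S (n + 1) A := by
  induction n generalizing A with
  | zero =>
    obtain ⟨P, _, _, p, hP, hp⟩ := exists_projective_surjective (R := R) A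
    exact ⟨P, inferInstance, inferInstance, p, hP, hp,
      IsSFlat.ker .of_flat h (LinearMap.ker p).injective_subtype
        (LinearMap.exact_subtype_ker_map p) hp⟩
  | succ n ih =>
    obtain ⟨P, _, _, p, hP, hp, h⟩ := h
    exact ⟨P, inferInstance, inferInstance, p, hP, hp, ih h⟩

theorem mono {m : ℕ} (h : SFlatDimLE S m A) (hmn : m ≤ n) : SFlatDimLE S n A := by
  induction hmn with
  | refl => exact h
  | step _ ih => exact ih.succ

theorem of_smul_eq_zero {s : R} (hs : s ∈ S) (h : ∀ a : A, s • a = 0) : SFlatDimLE S n A :=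
  mono (m := 0) (IsSFlat.of_smul_eq_zero hs h) n.zero_le

theorem of_isSIso (hB : SFlatDimLE S n B) (hf : IsSIso S f) : SFlatDimLE S n A := by
  obtain ⟨s, hs, k, hkf, hfk⟩ := hf
  have hker (x : LinearMap.ker f) : s • x = 0 := Subtype.ext <| by
    simpa using (LinearMap.congr_fun hkf x).symm
  have hcoker (z : B ⧸ LinearMap.range f) : s • z = 0 := by
    obtain ⟨y, rfl⟩ := Submodule.mkQ_surjective _ z
    rw [← map_smul]
    exact (Submodule.Quotient.mk_eq_zero _).2 ⟨k y, LinearMap.congr_fun hfk y⟩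
  have hrange : SFlatDimLE S n (LinearMap.range f) :=
    hB.ker (of_smul_eq_zero hs hcoker) (Submodule.injective_subtype _)
      (LinearMap.exact_subtype_mkQ _) (Submodule.mkQ_surjective _)
  exact (of_smul_eq_zero hs hker).extension hrange (LinearMap.ker f).injective_subtype
    (g := f.rangeRestrict) (fun x => by simp [Subtype.ext_iff])
    f.surjective_rangeRestrict

end SFlatDimLE

end SFlatDimLE

section Resolution

variable {R : Type u} [CommRing R] {S : Submonoid R} {M : Type u} [AddCommGroup M] [Module R M]
  {n : ℕ}

theorem IsSFlat.hasSFlatSResolution_zero (h : IsSFlat S M) : HasSFlatSResolution S M 0 := by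
  refine ⟨fun i => Nat.casesOn i (ModuleCat.of R M) fun _ => ModuleCat.of R PUnit.{u + 1},
    fun _ => 0, LinearMap.id, ?_, ?_, fun i => sExact_of_exact ?_, sExact_of_exact ?_,
    sExact_zero_right_of_surjective Function.surjective_id⟩
  · intro i hi
    obtain rfl := Nat.le_zero.1 hi
    exact h
  · rintro (_ | i) hi
    · exact (hi.ne rfl).elim
    · exact inferInstanceAs (Subsingleton PUnit)
  · exact (LinearMap.exact_zero_iff_injective _ _).2
      (Function.injective_of_subsingleton (α := PUnit) _)
  · exact (LinearMap.exact_zero_iff_injective _ _).2 Function.injective_id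

theorem HasSFlatSResolution.succ_of_exact {K P : Type u} [AddCommGroup K] [Module R K]
    [AddCommGroup P] [Module R P] (h : HasSFlatSResolution S K n) (hP : IsSFlat S P)
    {i : K →ₗ[R] P} {p : P →ₗ[R] M} (hi : Function.Injective i) (hip : Function.Exact i p)
    (hp : Function.Surjective p) : HasSFlatSResolution S M (n + 1) := by
  obtain ⟨F, d, ε, hF, hF', hd, ⟨s, hs, hker, hrange⟩, hε⟩ := h
  obtain ⟨t, ht, hε⟩ := sExact_zero_right_iff.1 hε
  refine ⟨fun j => Nat.casesOn j (ModuleCat.of R P) F, fun j => Nat.casesOn j (i ∘ₗ ε) d, p,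
    ?_, ?_, ?_, ⟨t, ht, fun x hx => ?_, ?_⟩, sExact_zero_right_of_surjective hp⟩
  · rintro (_ | j) hj
    · exact hP
    · exact hF j (Nat.le_of_succ_le_succ hj)
  · rintro (_ | j) hj
    · omega
    · exact hF' j (Nat.lt_of_succ_lt_succ hj)
  · rintro (_ | j)
    · refine ⟨s, hs, fun x hx => hker x (hi (hx.trans (map_zero i).symm)), fun y hy => ?_⟩
      exact (congrArg i (hrange y hy)).trans (map_zero i)
    · exact hd j
  · obtain ⟨y, rfl⟩ := (hip x).1 hx
    obtain ⟨z, hz⟩ := hε y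
    exact ⟨z, (congrArg i hz).trans (map_smul i t y)⟩
  · rintro _ ⟨z, rfl⟩
    exact (LinearMap.ker p).smul_mem t (hip.apply_apply_eq_zero (ε z))

theorem SFlatDimLE.hasSFlatSResolution (h : SFlatDimLE S n M) : HasSFlatSResolution S M n := by
  induction n generalizing M with
  | zero => exact IsSFlat.hasSFlatSResolution_zero h
  | succ n ih =>
    obtain ⟨P, _, _, p, _, hp, h⟩ := h
    exact (ih h).succ_of_exact .of_flat (LinearMap.ker p).injective_subtype
      (LinearMap.exact_subtype_ker_map p) hp

theorem SExact.sFlatDimLE_of_quotient_range {K F : Type u} [AddCommGroup K] [Module R K]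
    [AddCommGroup F] [Module R F] {d : K →ₗ[R] F} {ε : F →ₗ[R] M} (h : SExact S d ε)
    (hε : SExact S ε (0 : M →ₗ[R] PUnit.{1})) (hd : SFlatDimLE S n (F ⧸ LinearMap.range d)) :
    SFlatDimLE S n M := by
  obtain ⟨φ, ⟨s, hs, ψ, hψφ, hφψ⟩, -⟩ := h.exists_isSIso_quotient_range hε
  exact hd.of_isSIso ⟨s, hs, φ, hφψ, hψφ⟩

theorem HasSFlatSResolution.sFlatDimLE (h : HasSFlatSResolution S M n) : SFlatDimLE S n M := by
  induction n generalizing M with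
  | zero =>
    obtain ⟨F, d, ε, hF, hF', -, hdε, hε⟩ := h
    refine hdε.sFlatDimLE_of_quotient_range hε ?_
    have := hF' 1 zero_lt_one
    have hd : LinearMap.range (d 0) = ⊥ := by
      rw [LinearMap.range_eq_bot, Subsingleton.elim (d 0) 0]
    exact SFlatDimLE.congr (hF 0 le_rfl) (Submodule.quotEquivOfEqBot _ hd)
  | succ n ih =>
    obtain ⟨F, d, ε, hF, hF', hd, hdε, hε⟩ := h
    refine hdε.sFlatDimLE_of_quotient_range hε ?_
    have hrange : SFlatDimLE S n (LinearMap.range (d 0)) :=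
      ih ⟨fun i => F (i + 1), fun i => d (i + 1), (d 0).rangeRestrict,
        fun i hi => hF _ (Nat.succ_le_succ hi), fun i hi => hF' _ (Nat.succ_lt_succ hi),
        fun i => hd _, by simpa only [SExact, LinearMap.ker_rangeRestrict] using hd 0,
        sExact_zero_right_of_surjective (d 0).surjective_rangeRestrict⟩
    exact hrange.coker (SFlatDimLE.mono (m := 0) (hF 0 (Nat.zero_le _)) (Nat.zero_le _))
      (Submodule.injective_subtype _) (LinearMap.exact_subtype_mkQ _) (Submodule.mkQ_surjective _)

theorem sFlatDim_le_iff : sFlatDim S M ≤ n ↔ SFlatDimLE S n M := by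
  refine ⟨fun h => ?_, fun h => iInf₂_le n h.hasSFlatSResolution⟩
  obtain ⟨m, hm⟩ := iInf_lt_iff.1 (h.trans_lt (Nat.cast_lt.2 n.lt_succ_self))
  obtain ⟨hm, hmn⟩ := iInf_lt_iff.1 hm
  exact hm.sFlatDimLE.mono (Nat.lt_succ_iff.1 (Nat.cast_lt.1 hmn))

theorem sWeakGlobalDim_le_iff :
    sWeakGlobalDim S ≤ n ↔ ∀ (M : Type u) [AddCommGroup M] [Module R M], SFlatDimLE S n M :=
  ⟨fun h M _ _ => sFlatDim_le_iff.1 ((le_iSup (fun M : ModuleCat.{u} R => sFlatDim S M)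
    (ModuleCat.of R M)).trans h), fun h => iSup_le fun M => sFlatDim_le_iff.2 (h M)⟩

end Resolution

section BaseChange

theorem cancelBaseChange_rTensor {A B : Type*} [CommRing A] [CommRing B] [Algebra A B]
    {L X Y : Type*} [AddCommGroup L] [Module A L]
    [AddCommGroup X] [Module A X] [Module B X] [IsScalarTower A B X]
    [AddCommGroup Y] [Module A Y] [Module B Y] [IsScalarTower A B Y]
    (f : X →ₗ[B] Y) (z : X ⊗[B] (B ⊗[A] L)) :
    TensorProduct.AlgebraTensorModule.cancelBaseChange A B B Y L (f.rTensor (B ⊗[A] L) z) =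
      (f.restrictScalars A).rTensor L
        (TensorProduct.AlgebraTensorModule.cancelBaseChange A B B X L z) := by
  induction z with
  | zero => simp
  | add z w hz hw => simp only [map_add, hz, hw]
  | tmul x w =>
    induction w with
    | zero => simp
    | add w v hw hv => simp only [TensorProduct.tmul_add, map_add, hw, hv]
    | tmul b l => simp

variable {A B : Type u} [CommRing A] [CommRing B] [Algebra A B] {S : Submonoid A}
  {T : Submonoid B} {L : Type u} [AddCommGroup L] [Module A L] {n : ℕ}

theorem IsSFlat.baseChange (hST : ∀ s ∈ S, algebraMap A B s ∈ T) (h : IsSFlat S L) :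
    IsSFlat T (B ⊗[A] L) :=
  isSFlat_iff.2 fun X Y _ _ _ _ f hf => by
    let : Module A X := Module.compHom X (algebraMap A B)
    let : Module A Y := Module.compHom Y (algebraMap A B)
    have : IsScalarTower A B X := .of_algebraMap_smul fun _ _ => rfl
    have : IsScalarTower A B Y := .of_algebraMap_smul fun _ _ => rfl
    let φ := TensorProduct.AlgebraTensorModule.cancelBaseChange A B B X L
    obtain ⟨s, hs, hsf⟩ := isSFlat_iff.1 h X Y (f.restrictScalars A) hf
    refine ⟨_, hST s hs, fun z hz => φ.injective ?_⟩
    rw [map_smul, map_zero, algebraMap_smul]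
    exact hsf _ (by rw [← cancelBaseChange_rTensor, hz, map_zero])

theorem SFlatDimLE.baseChange [Module.Flat A B] (hST : ∀ s ∈ S, algebraMap A B s ∈ T)
    (h : SFlatDimLE S n L) : SFlatDimLE T n (B ⊗[A] L) := by
  induction n generalizing L with
  | zero => exact IsSFlat.baseChange hST h
  | succ n ih =>
    obtain ⟨P, _, _, p, _, hp, h⟩ := h
    exact (ih h).succ_of_exact (f := (LinearMap.ker p).subtype.baseChange B)
      (g := p.baseChange B)
      (Module.Flat.lTensor_preserves_injective_linearMap _ (LinearMap.ker p).injective_subtype)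
      (lTensor_exact B (LinearMap.exact_subtype_ker_map p) hp) (LinearMap.lTensor_surjective B hp)

/-- Along a flat epimorphism `A → B`, every `B`-module `L` is its own base change: `B ⊗ L ≃ L`. -/
theorem SFlatDimLE.of_flat_of_isEpi [Module.Flat A B] [Algebra.IsEpi A B] [Module B L]
    [IsScalarTower A B L] (hST : ∀ s ∈ S, algebraMap A B s ∈ T) (h : SFlatDimLE S n L) :
    SFlatDimLE T n L :=
  (h.baseChange hST).congr
    (LinearEquiv.ofBijective (LinearMap.liftBaseChange B LinearMap.id)
      ⟨Algebra.injective_lift_lsmul A B L, fun l => ⟨1 ⊗ₜ l, by simp⟩⟩).symm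

theorem sWeakGlobalDim_le_of_flat_of_isEpi [Module.Flat A B] [Algebra.IsEpi A B]
    (hST : ∀ s ∈ S, algebraMap A B s ∈ T) : sWeakGlobalDim T ≤ sWeakGlobalDim S := by
  cases hn : sWeakGlobalDim S using ENat.recTopCoe with
  | top => exact le_top
  | coe n =>
    refine sWeakGlobalDim_le_iff.2 fun M _ _ => ?_
    let : Module A M := Module.compHom M (algebraMap A B)
    have : IsScalarTower A B M := .of_algebraMap_smul fun _ _ => rfl
    exact (sWeakGlobalDim_le_iff.1 hn.le M).of_flat_of_isEpi hST

end BaseChange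

theorem sWeakGlobalDim_map_ringEquiv_le {A B : Type u} [CommRing A] [CommRing B] (e : A ≃+* B)
    (S : Submonoid A) : sWeakGlobalDim (S.map (e : A →+* B)) ≤ sWeakGlobalDim S := by
  let : Algebra A B := (e : A →+* B).toAlgebra
  have : Module.Flat A B :=
    .of_linearEquiv (LinearEquiv.ofBijective (Algebra.linearMap A B) e.bijective).symm
  have : Algebra.IsEpi A B := Algebra.isEpi_of_surjective_algebraMap A B e.surjective
  exact sWeakGlobalDim_le_of_flat_of_isEpi fun s hs => Submonoid.mem_map_of_mem _ hs

theorem sWeakGlobalDim_map_ringEquiv {A B : Type u} [CommRing A] [CommRing B] (e : A ≃+* B)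
    (S : Submonoid A) : sWeakGlobalDim (S.map (e : A →+* B)) = sWeakGlobalDim S := by
  refine (sWeakGlobalDim_map_ringEquiv_le e S).antisymm ?_
  have hS : (S.map (e : A →+* B)).map (e.symm : B →+* A) = S := by
    ext x
    simp
  simpa only [hS] using sWeakGlobalDim_map_ringEquiv_le e.symm (S.map (e : A →+* B))

section Polynomial

open Polynomial

section PolynomialModule

variable {A : Type*} [CommRing A] {M N : Type*} [AddCommGroup M] [Module A M] [AddCommGroup N]
  [Module A N]

theorem X_smul_single (i : ℕ) (m : M) :
    (X : A[X]) • PolynomialModule.single A i m = PolynomialModule.single A (i + 1) m := by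
  rw [← monomial_one_one_eq_X, PolynomialModule.monomial_smul_single, one_smul, add_comm]

theorem coeff_X_smul_zero (q : PolynomialModule A M) : ((X : A[X]) • q).coeff 0 = 0 := by
  simp [← monomial_one_one_eq_X]

theorem coeff_X_smul_succ (q : PolynomialModule A M) (i : ℕ) :
    ((X : A[X]) • q).coeff (i + 1) = q.coeff i := by
  simp [← monomial_one_one_eq_X]

/-- The `i`-th coefficient of an element of `M[X]`, as a linear map. -/
noncomputable def lcoeffPolynomialModule (A M : Type*) [CommRing A] [AddCommGroup M]
    [Module A M] (i : ℕ) : PolynomialModule A M →ₗ[A] M :=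
  Finsupp.lapply i ∘ₗ (PolynomialModule.coeffLinearEquiv A A).toLinearMap

variable [Module A[X] M] [IsScalarTower A A[X] M] [Module A[X] N] [IsScalarTower A A[X] N]

/-- An `A`-linear map between `A[X]`-modules that commutes with `X` is `A[X]`-linear. -/
def linearMapOfCommX (f : M →ₗ[A] N) (hf : ∀ m, f ((X : A[X]) • m) = (X : A[X]) • f m) :
    M →ₗ[A[X]] N where
  toFun := f
  map_add' := map_add f
  map_smul' p m := by
    rw [RingHom.id_apply]
    induction p using Polynomial.induction_on generalizing m with
    | C a => rw [← algebraMap_eq, algebraMap_smul, algebraMap_smul, map_smul]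
    | add p q hp hq => rw [add_smul, add_smul, map_add, hp, hq]
    | monomial i a ih => rw [pow_succ, ← mul_assoc, mul_smul, ih, hf, ← mul_smul]

/-- The map `X ⊗ 1 - 1 ⊗ X` on `M[X] = A[X] ⊗ M`, for an `A[X]`-module `M`. -/
noncomputable def polynomialModuleDiff (A M : Type*) [CommRing A] [AddCommGroup M] [Module A M]
    [Module A[X] M] [IsScalarTower A A[X] M] :
    PolynomialModule A M →ₗ[A[X]] PolynomialModule A M :=
  LinearMap.lsmul A[X] _ X -
    linearMapOfCommX (PolynomialModule.map A ((LinearMap.lsmul A[X] M X).restrictScalars A))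
      fun q => by simp [PolynomialModule.map_smul]

/-- The evaluation map `M[X] → M`, `∑ Xⁱ ⊗ mᵢ ↦ ∑ Xⁱ • mᵢ`, for an `A[X]`-module `M`. -/
noncomputable def polynomialModuleEval (A M : Type*) [CommRing A] [AddCommGroup M] [Module A M]
    [Module A[X] M] [IsScalarTower A A[X] M] : PolynomialModule A M →ₗ[A[X]] M :=
  linearMapOfCommX
    ((PolynomialModule.eval (M := M) (X : A[X])).restrictScalars A ∘ₗ
      PolynomialModule.map A[X] (LinearMap.id : M →ₗ[A] M))
    fun q => by simp [PolynomialModule.map_smul]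

theorem polynomialModuleDiff_single (i : ℕ) (m : M) :
    polynomialModuleDiff A M (PolynomialModule.single A i m) =
      PolynomialModule.single A (i + 1) m - PolynomialModule.single A i ((X : A[X]) • m) := by
  simp [polynomialModuleDiff, linearMapOfCommX, X_smul_single]

theorem coeff_polynomialModuleDiff_succ (q : PolynomialModule A M) (i : ℕ) :
    (polynomialModuleDiff A M q).coeff (i + 1) = q.coeff i - (X : A[X]) • q.coeff (i + 1) := by
  rw [← coeff_X_smul_succ q]
  rfl

theorem polynomialModuleEval_single (i : ℕ) (m : M) :
    polynomialModuleEval A M (PolynomialModule.single A i m) = (X ^ i : A[X]) • m := by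
  simp [polynomialModuleEval, linearMapOfCommX]

theorem polynomialModuleEval_surjective : Function.Surjective (polynomialModuleEval A M) :=
  fun m => ⟨PolynomialModule.single A 0 m, by simp [polynomialModuleEval_single]⟩

/-- The coefficients of an element of the kernel satisfy `qᵢ = X • qᵢ₊₁` and vanish for large
`i`. -/
theorem polynomialModuleDiff_injective : Function.Injective (polynomialModuleDiff A M) := by
  refine (injective_iff_map_eq_zero _).2 fun q hq => PolynomialModule.coeff_eq_zero.1 ?_
  have hcoeff (i : ℕ) : q.coeff i = (X : A[X]) • q.coeff (i + 1) := by
    rw [← sub_eq_zero, ← coeff_polynomialModuleDiff_succ, hq]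
    rfl
  obtain ⟨N, hN⟩ := q.coeff.support.bddAbove
  ext i
  by_contra hi
  have hmem (k : ℕ) : i + k ∈ q.coeff.support := by
    induction k with
    | zero => simpa using hi
    | succ k ih =>
      rw [Finsupp.mem_support_iff, hcoeff] at ih
      exact Finsupp.mem_support_iff.2 (right_ne_zero_of_smul ih)
  have := hN (hmem (N + 1))
  omega

theorem polynomialModuleEval_comp_diff :
    polynomialModuleEval A M ∘ₗ polynomialModuleDiff A M = 0 := by
  ext q
  induction q using PolynomialModule.induction_linear with
  | zero => simp
  | add p q hp hq => rw [map_add, hp, hq, map_add]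
  | single i m =>
    simp [polynomialModuleDiff_single, polynomialModuleEval_single, pow_succ, mul_smul]

theorem sub_single_eval_mem_range_diff (q : PolynomialModule A M) :
    q - PolynomialModule.single A 0 (polynomialModuleEval A M q) ∈
      LinearMap.range (polynomialModuleDiff A M) := by
  induction q using PolynomialModule.induction_linear with
  | zero => simp
  | add p q hp hq =>
    rw [map_add, PolynomialModule.single_add, add_sub_add_comm]
    exact add_mem hp hq
  | single i m =>
    rw [polynomialModuleEval_single]
    induction i generalizing m with
    | zero => simp
    | succ i ih =>
      have := add_mem (LinearMap.mem_range_self (polynomialModuleDiff A M)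
        (PolynomialModule.single A i m)) (ih ((X : A[X]) • m))
      rwa [polynomialModuleDiff_single, sub_add_sub_cancel, ← mul_smul, ← pow_succ] at this

theorem exact_polynomialModuleDiff_eval :
    Function.Exact (polynomialModuleDiff A M) (polynomialModuleEval A M) :=
  LinearMap.exact_of_comp_eq_zero_of_ker_le_range polynomialModuleEval_comp_diff fun q hq => by
    simpa [LinearMap.mem_ker.1 hq] using sub_single_eval_mem_range_diff q

end PolynomialModule

variable {A : Type u} [CommRing A] {S : Submonoid A} {M : Type u} [AddCommGroup M] [Module A M]
  {n : ℕ}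

theorem SFlatDimLE.polynomialModule (h : SFlatDimLE S n M) :
    SFlatDimLE (S.map (C : A →+* A[X])) n (PolynomialModule A M) :=
  (h.baseChange fun _ hs => Submonoid.mem_map_of_mem _ hs).congr
    (PolynomialModule.polynomialTensorProductLEquivPolynomialModule A M).symm

theorem SFlatDimLE.polynomial [Module A[X] M] [IsScalarTower A A[X] M] (h : SFlatDimLE S n M) :
    SFlatDimLE (S.map (C : A →+* A[X])) (n + 1) M :=
  h.polynomialModule.coker h.polynomialModule.succ polynomialModuleDiff_injective
    exact_polynomialModuleDiff_eval polynomialModuleEval_surjective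

theorem sWeakGlobalDim_polynomial_le :
    sWeakGlobalDim (S.map (C : A →+* A[X])) ≤ sWeakGlobalDim S + 1 := by
  cases hn : sWeakGlobalDim S using ENat.recTopCoe with
  | top => exact le_top
  | coe n =>
    rw [← Nat.cast_succ]
    refine sWeakGlobalDim_le_iff.2 fun M _ _ => ?_
    let : Module A M := Module.compHom M (C : A →+* A[X])
    have : IsScalarTower A A[X] M := .of_algebraMap_smul fun _ _ => rfl
    exact (sWeakGlobalDim_le_iff.1 hn.le M).polynomial

section KilledByX

variable {A : Type*} [CommRing A] {M : Type*} [AddCommGroup M] [Module A M] [Module A[X] M]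
  [IsScalarTower A A[X] M]

theorem smul_eq_coeff_zero_smul (hX : ∀ m : M, (X : A[X]) • m = 0) (p : A[X]) (m : M) :
    p • m = p.coeff 0 • m := by
  conv_lhs => rw [← divX_mul_X_add p]
  rw [add_smul, mul_smul, hX, smul_zero, zero_add, ← algebraMap_eq, algebraMap_smul]

/-- For an `A[X]`-module `M` killed by `X`, the `A[X]`-linear extension `P[X] → M` of a map
`P → M` of `A`-modules: the constant coefficient followed by `P → M`. -/
noncomputable def constantCoeffMap {P : Type*} [AddCommGroup P] [Module A P]
    (hX : ∀ m : M, (X : A[X]) • m = 0) (p : P →ₗ[A] M) : PolynomialModule A P →ₗ[A[X]] M :=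
  linearMapOfCommX (p ∘ₗ lcoeffPolynomialModule A P 0) fun q => by
    rw [hX, LinearMap.comp_apply]
    exact (congrArg p (coeff_X_smul_zero q)).trans (map_zero p)

end KilledByX

theorem exists_module_X_smul_eq_zero {A : Type*} [CommRing A] (M : Type*) [AddCommGroup M]
    [Module A M] :
    ∃ _ : Module A[X] M, IsScalarTower A A[X] M ∧ ∀ m : M, (X : A[X]) • m = 0 := by
  let : Module A[X] M := Module.compHom M (constantCoeff : A[X] →+* A)
  have hsmul (q : A[X]) (m : M) : q • m = q.coeff 0 • m := rfl
  refine ⟨inferInstance, .of_algebraMap_smul fun a m => ?_, fun m => ?_⟩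
  · rw [hsmul, algebraMap_eq, coeff_C_zero]
  · rw [hsmul, coeff_X_zero, zero_smul]

theorem IsSFlat.exists_smul_eq_zero_of_isSMulRegular {R : Type u} [CommRing R] {S : Submonoid R}
    {F : Type u} [AddCommGroup F] [Module R F] (h : IsSFlat S F) {r : R} (hr : IsSMulRegular R r)
    (hF : ∀ x : F, r • x = 0) : ∃ s ∈ S, ∀ x : F, s • x = 0 := by
  obtain ⟨s, hs, hsr⟩ := isSFlat_iff.1 h R R (LinearMap.lsmul R R r) hr
  refine ⟨s, hs, fun x => ?_⟩
  have hx : s • (1 : R) ⊗ₜ[R] x = 0 := hsr _ <| by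
    rw [LinearMap.rTensor_tmul, LinearMap.lsmul_apply, TensorProduct.smul_tmul, hF,
      TensorProduct.tmul_zero]
  simpa using congrArg (TensorProduct.lid R F) hx

variable [Module A[X] M] [IsScalarTower A A[X] M]

/-- The splitting of `L / X L → M` is `p v ↦ ν v`. -/
theorem IsSFlat.of_retract_quotient_X {L : Type u} [AddCommGroup L] [Module A L] [Module A[X] L]
    [IsScalarTower A A[X] L] (hL : IsSFlat (S.map (C : A →+* A[X])) L)
    (hX : ∀ m : M, (X : A[X]) • m = 0) {P : Type*} [AddCommGroup P] [Module A P] {p : P →ₗ[A] M}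
    (hp : Function.Surjective p) (ν : P →ₗ[A] L) (σ : L →ₗ[A[X]] M) (hσν : ∀ v, σ (ν v) = p v)
    (hν : ∀ v, p v = 0 → ∃ l, ν v = (X : A[X]) • l) : IsSFlat S M := by
  let : Algebra A[X] A := (constantCoeff : A[X] →+* A).toAlgebra
  have : IsScalarTower A[X] A M :=
    .of_algebraMap_smul fun q m => (smul_eq_coeff_zero_smul hX q m).symm
  have htmul (q : A[X]) (l : L) :
      (1 : A) ⊗ₜ[A[X]] (q • l) = q.coeff 0 • (1 : A) ⊗ₜ[A[X]] l := by
    rw [TensorProduct.tmul_smul, ← algebraMap_smul A q]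
    rfl
  let τ : P →ₗ[A] A ⊗[A[X]] L :=
    { toFun v := 1 ⊗ₜ ν v
      map_add' v w := by rw [map_add, TensorProduct.tmul_add]
      map_smul' a v := by
        rw [map_smul, ← algebraMap_smul A[X] a, htmul, algebraMap_eq, coeff_C_zero,
          RingHom.id_apply] }
  obtain ⟨ι, hι⟩ := exists_comp_eq_of_ker_le_ker hp (h := τ) fun v hv => by
    obtain ⟨l, hl⟩ := hν v hv
    rw [LinearMap.mem_ker, LinearMap.coe_mk, AddHom.coe_mk, hl, htmul, coeff_X_zero, zero_smul]
  have hAL : IsSFlat S (A ⊗[A[X]] L) := hL.baseChange <| by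
    rintro _ ⟨s, hs, rfl⟩
    simpa [RingHom.algebraMap_toAlgebra] using hs
  refine hAL.of_retract ι (σ.liftBaseChange A) ?_
  rw [← LinearMap.cancel_right hp, LinearMap.comp_assoc, hι]
  ext v
  simp [τ, hσν]

/-- With `0 → L → P[X] → M → 0` exact and `P` projective, `M` is a direct summand of `L / X L`:
the map `L → M` given by the coefficient of `X` has the section `m ↦ X v` for `v ∈ P` over `m`. -/
theorem SFlatDimLE.isSFlat_of_polynomial (hX : ∀ m : M, (X : A[X]) • m = 0)
    (h : SFlatDimLE (S.map (C : A →+* A[X])) 1 M) : IsSFlat S M := by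
  obtain ⟨P, _, _, p, _, hp⟩ := exists_projective_surjective (R := A) M
  let f : PolynomialModule A P →ₗ[A[X]] M := constantCoeffMap hX p
  have hf_single (v : P) : f (PolynomialModule.single A 0 v) = p v := by
    simp [f, constantCoeffMap, linearMapOfCommX, lcoeffPolynomialModule]
  have hf : Function.Surjective f := fun m => (hp m).imp' _ fun v hv => (hf_single v).trans hv
  have hL : IsSFlat (S.map (C : A →+* A[X])) (LinearMap.ker f) :=
    SFlatDimLE.ker (n := 0) (of_projective (A := P)).polynomialModule h
      (LinearMap.ker f).injective_subtype (LinearMap.exact_subtype_ker_map f) hf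
  let ν : P →ₗ[A] LinearMap.ker f :=
    { toFun v := ⟨(X : A[X]) • PolynomialModule.single A 0 v, by simp [hX]⟩
      map_add' v w := Subtype.ext (by simp)
      map_smul' a v := Subtype.ext <| by
        simp [PolynomialModule.single_smul, smul_comm a (X : A[X])] }
  let σ : LinearMap.ker f →ₗ[A[X]] M :=
    linearMapOfCommX
      (p ∘ₗ lcoeffPolynomialModule A P 1 ∘ₗ (LinearMap.ker f).subtype.restrictScalars A)
      fun l => by
        rw [hX]
        exact (congrArg p (coeff_X_smul_succ l.1 0)).trans l.2
  refine hL.of_retract_quotient_X hX hp ν σ (fun v => ?_) fun v hv =>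
    ⟨⟨PolynomialModule.single A 0 v, (hf_single v).trans hv⟩, rfl⟩
  exact congrArg p (by simp [ν, lcoeffPolynomialModule])

theorem SFlatDimLE.of_polynomial (hX : ∀ m : M, (X : A[X]) • m = 0)
    (h : SFlatDimLE (S.map (C : A →+* A[X])) (n + 1) M) : SFlatDimLE S n M := by
  induction n generalizing M with
  | zero => exact h.isSFlat_of_polynomial hX
  | succ n ih =>
    obtain ⟨P, _, _, p, _, hp⟩ := exists_projective_surjective (R := A) M
    obtain ⟨_, _, hXP⟩ := exists_module_X_smul_eq_zero (A := A) P
    let g : P →ₗ[A[X]] M := linearMapOfCommX p fun v => by rw [hXP, hX, map_zero]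
    have hP : SFlatDimLE (S.map (C : A →+* A[X])) (n + 1) P :=
      (of_projective (S := S) (n := n) (A := P)).polynomial
    have hK : SFlatDimLE (S.map (C : A →+* A[X])) (n + 1) (LinearMap.ker g) :=
      hP.ker h (LinearMap.ker g).injective_subtype (LinearMap.exact_subtype_ker_map g) hp
    exact (ih (fun v => Subtype.ext (hXP v)) hK).succ_of_exact
      (f := (LinearMap.ker g).subtype.restrictScalars A) (g := p)
      (LinearMap.ker g).injective_subtype (LinearMap.exact_subtype_ker_map g) hp

theorem add_one_le_sWeakGlobalDim_polynomial (hS : (0 : A) ∉ S) :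
    sWeakGlobalDim S + 1 ≤ sWeakGlobalDim (S.map (C : A →+* A[X])) := by
  cases hn : sWeakGlobalDim (S.map (C : A →+* A[X])) using ENat.recTopCoe with
  | top => exact le_top
  | coe n =>
    replace hn := sWeakGlobalDim_le_iff.1 hn.le
    cases n with
    | zero =>
      obtain ⟨_, _, hX⟩ := exists_module_X_smul_eq_zero (A := A) A
      obtain ⟨_, ⟨s, hs, rfl⟩, hs0⟩ :=
        IsSFlat.exists_smul_eq_zero_of_isSMulRegular (hn A) isRegular_X.left hX
      have : s = 0 := by simpa [smul_eq_coeff_zero_smul hX] using hs0 1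
      exact (hS (this ▸ hs)).elim
    | succ n =>
      rw [Nat.cast_succ]
      gcongr
      refine sWeakGlobalDim_le_iff.2 fun M _ _ => ?_
      obtain ⟨_, _, hX⟩ := exists_module_X_smul_eq_zero (A := A) M
      exact (hn M).of_polynomial hX

theorem sWeakGlobalDim_polynomial (hS : (0 : A) ∉ S) :
    sWeakGlobalDim (S.map (C : A →+* A[X])) = sWeakGlobalDim S + 1 :=
  sWeakGlobalDim_polynomial_le.antisymm (add_one_le_sWeakGlobalDim_polynomial hS)

end Polynomial

theorem mainTheorem2 {R : Type u} [CommRing R] (S : Submonoid R) (hS : (0 : R) ∉ S)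
    (n : ℕ) (hn : 1 ≤ n) :
    sWeakGlobalDim (S.map (MvPolynomial.C : R →+* MvPolynomial (Fin n) R)) =
      sWeakGlobalDim S + (n : ℕ∞) := by
  clear hn
  induction n with
  | zero =>
    rw [Nat.cast_zero, add_zero]
    exact sWeakGlobalDim_map_ringEquiv (MvPolynomial.isEmptyRingEquiv R (Fin 0)).symm S
  | succ n ih =>
    have h0 : (0 : MvPolynomial (Fin n) R) ∉ S.map (MvPolynomial.C : R →+* _) := by
      rintro ⟨s, hs, h⟩
      exact hS ((MvPolynomial.C_eq_zero.1 h) ▸ hs)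
    rw [← sWeakGlobalDim_map_ringEquiv (MvPolynomial.finSuccEquiv R n).toRingEquiv,
      Nat.cast_succ, ← add_assoc, ← ih, ← sWeakGlobalDim_polynomial h0]
    congr 1
    ext x
    simp [MvPolynomial.finSuccEquiv_apply]
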